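/- A Pisot number is a real algebraic integer $\alpha>1$ all of whose conjugates over $\mathbb Q$ other than $\alpha$ itself have modulus less than $1$; its degree is the degree of its minimal polynomial over $\mathbb Q$. Write $\|x\|$ for the distance from a real number $x$ to the nearest integer, and for a Pisot number $\alpha$ put $$L(\alpha)=\sup_{\xi\in\mathbb R}\ \liminf_{n\to\infty}\|\xi\alpha^n\|.$$ Let $\alpha$ be a Pisot number of degree at most $4$. Then: 1) $L(\alpha)=\frac{3}{17}$ if and only if $\alpha$ is a root of $x^4-x^3-1=0$; 2) $L(\alpha)=\frac15$ if and only if $\alpha$ is a root of $x^2-x-1=0$ or of $x^3-x-1=0$; 3) $L(\alpha)=\frac{4}{13}$ if and only if $\alpha$ is a root of $x^3-2x^2-x+1=0$. -/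

import Mathlib

open Filter

/-- A Pisot number: a real algebraic integer greater than `1` all of whose other
conjugates over `ℚ` lie strictly inside the complex unit disc. -/
def IsPisot (α : ℝ) : Prop :=
  IsIntegral ℤ α ∧ 1 < α ∧
    ∀ z : ℂ, Polynomial.aeval z (minpoly ℚ α) = 0 → z ≠ (α : ℂ) → ‖z‖ < 1

/-- The distance from a real number to the nearest integer. -/
noncomputable def distNearestInt (x : ℝ) : ℝ := |x - (round x : ℝ)|

/-- `L(X) = sup_ξ liminf_n ‖ξ xₙ‖`, where `‖·‖` is the distance to the nearest integer.
All the distances lie in `[0, 1/2]`, so the real `liminf` and supremum are genuine. -/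
noncomputable def seqL (x : ℕ → ℝ) : ℝ :=
  ⨆ ξ : ℝ, liminf (fun n : ℕ => distNearestInt (ξ * x n)) atTop

/-- `L(α)`, the value of `L` on the sequence of powers of `α`. -/
noncomputable def pisotL (α : ℝ) : ℝ := seqL (fun n : ℕ => α ^ n)

open Polynomial Topology

/-! Let `P` be the minimal polynomial of `α` over `ℤ` and let `S` be the shift on sequences. A real
sequence killed by `P(S)` is `ξ α ^ n + o(1)`, because the other roots of `P` lie inside the unit
disc. If `P(S) y` is only integer-valued, monicity of `P` supplies an integer correction making it
zero without changing distances to integers. Hence every such `y` bounds `L(α)` from below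
(`IsPisot.le_pisotL`).

Two kinds of `y` suffice. Progressions `c g ^ n / q` with `q ∣ P(g)` give the four exact values from
below and, with `g = ±1`, force `|P(±1)| = 1` unless `L(α) ≥ 1/3`. When `P(1) = -1`, a sequence of
period four around `1/2` gives `L(α) > 4/13` unless `P(i)` is small. In degree at most four these
constraints, a norm bound and the removal of `x ^ 4 - x - 1` leave four polynomials
(`IsPisot.lt_pisotL_or`).

For the matching upper bounds, let the terms of `ξ α ^ n` stay within `1/2 - c` of half-integers,
with deviations `y`. As `P(1) = -1`, `P(S) y` is half an odd integer; being smaller than `1` in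
modulus it is `±1/2`. Only finitely many sign patterns over a bounded window need refuting, each by
linear inequalities. The values `3/17 < 1/5 < 4/13` are distinct, so each determines its equations.
-/

/-! ### Distance to the nearest integer and bounds for `seqL` -/

theorem distNearestInt_le_half (x : ℝ) : distNearestInt x ≤ 1 / 2 :=
  abs_sub_round x

theorem distNearestInt_nonneg (x : ℝ) : 0 ≤ distNearestInt x :=
  abs_nonneg _

theorem distNearestInt_le_abs_sub (x : ℝ) (m : ℤ) : distNearestInt x ≤ |x - m| :=
  round_le x m

theorem distNearestInt_add_int (x : ℝ) (m : ℤ) :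
    distNearestInt (x + m) = distNearestInt x := by
  simp [distNearestInt]

theorem distNearestInt_le_add_abs_sub (x y : ℝ) :
    distNearestInt x ≤ distNearestInt y + |x - y| := by
  have h := distNearestInt_le_abs_sub x (round y)
  have h2 := abs_sub_le x y (round y)
  unfold distNearestInt at *
  linarith

theorem le_distNearestInt {x c : ℝ} (m : ℤ) (h1 : m + c ≤ x) (h2 : x ≤ m + 1 - c) :
    c ≤ distNearestInt x := by
  unfold distNearestInt
  rcases le_or_gt (round x) m with h | h
  · have : (round x : ℝ) ≤ m := by exact_mod_cast h
    exact le_trans (by linarith) (le_abs_self _)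
  · have : (m : ℝ) + 1 ≤ round x := by exact_mod_cast h
    exact le_trans (by linarith) (neg_le_abs _)

theorem abs_fract_sub_half_lt {x c : ℝ} (h : c < distNearestInt x) :
    |Int.fract x - 1 / 2| < 1 / 2 - c := by
  rw [distNearestInt, abs_sub_round_eq_min, lt_min_iff] at h
  rw [abs_lt]
  constructor <;> linarith

theorem isBoundedUnder_ge_distNearestInt (u : ℕ → ℝ) :
    IsBoundedUnder (· ≥ ·) atTop (fun n => distNearestInt (u n)) :=
  isBoundedUnder_of ⟨0, fun _ => distNearestInt_nonneg _⟩

theorem isCoboundedUnder_ge_distNearestInt (u : ℕ → ℝ) :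
    IsCoboundedUnder (· ≥ ·) atTop (fun n => distNearestInt (u n)) :=
  IsBoundedUnder.isCoboundedUnder_ge
    (isBoundedUnder_of ⟨1 / 2, fun _ => distNearestInt_le_half _⟩)

theorem liminf_distNearestInt_le_half (u : ℕ → ℝ) :
    liminf (fun n => distNearestInt (u n)) atTop ≤ 1 / 2 :=
  liminf_le_of_le (isBoundedUnder_ge_distNearestInt u) fun _ hb => by
    obtain ⟨n, hn⟩ := hb.exists
    exact hn.trans (distNearestInt_le_half _)

theorem liminf_distNearestInt_le_seqL (x : ℕ → ℝ) (ξ : ℝ) :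
    liminf (fun n => distNearestInt (ξ * x n)) atTop ≤ seqL x :=
  le_ciSup (f := fun ξ : ℝ => liminf (fun n => distNearestInt (ξ * x n)) atTop)
    ⟨1 / 2, by rintro _ ⟨ξ, rfl⟩; exact liminf_distNearestInt_le_half _⟩ ξ

theorem le_seqL_of_tendsto {x u : ℕ → ℝ} {ξ c : ℝ}
    (h : Tendsto (fun n => u n - ξ * x n) atTop (𝓝 0)) (hu : ∀ n, c ≤ distNearestInt (u n)) :
    c ≤ seqL x := by
  refine le_trans ?_ (liminf_distNearestInt_le_seqL x ξ)
  refine le_of_forall_pos_sub_le fun ε hε => ?_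
  refine le_liminf_of_le (isCoboundedUnder_ge_distNearestInt _) ?_
  filter_upwards [(Metric.tendsto_nhds.1 h) ε hε] with n hn
  have h1 := distNearestInt_le_add_abs_sub (u n) (ξ * x n)
  rw [Real.dist_eq, sub_zero] at hn
  linarith [hu n]

theorem seqL_le_of_forall_not {x : ℕ → ℝ} {c : ℝ}
    (h : ∀ ξ : ℝ, ∀ N : ℕ, ∃ n ≥ N, distNearestInt (ξ * x n) ≤ c) : seqL x ≤ c := by
  refine ciSup_le fun ξ => ?_
  by_contra! hlt
  obtain ⟨N, hN⟩ := eventually_atTop.1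
    (eventually_lt_of_lt_liminf hlt (isBoundedUnder_ge_distNearestInt _))
  obtain ⟨n, hn, hle⟩ := h ξ N
  exact (hN n hn).not_ge hle

/-! ### Linear recurrences through the shift operator -/

/-- The left shift on sequences, as a linear endomorphism. -/
def seqShift (R : Type*) [CommRing R] : Module.End R (ℕ → R) :=
  LinearMap.funLeft R R Nat.succ

theorem seqShift_apply {R : Type*} [CommRing R] (u : ℕ → R) (n : ℕ) :
    seqShift R u n = u (n + 1) := rfl

theorem seqShift_pow_apply {R : Type*} [CommRing R] (u : ℕ → R) (k n : ℕ) :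
    (seqShift R ^ k) u n = u (n + k) := by
  induction k generalizing n with
  | zero => simp
  | succ k ih =>
    rw [pow_succ', Module.End.mul_apply, seqShift_apply, ih]
    congr 1
    ring

theorem aeval_seqShift_apply {R : Type*} [CommRing R] (p : R[X]) (u : ℕ → R) (n : ℕ) :
    aeval (seqShift R) p u n = ∑ i ∈ Finset.range (p.natDegree + 1), p.coeff i * u (n + i) := by
  rw [aeval_eq_sum_range, LinearMap.sum_apply, Finset.sum_apply]
  refine Finset.sum_congr rfl fun i _ => ?_
  rw [LinearMap.smul_apply, Pi.smul_apply, seqShift_pow_apply, smul_eq_mul]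

theorem aeval_seqShift_geom {R : Type*} [CommRing R] (p : R[X]) (c r : R) :
    aeval (seqShift R) p (fun n => c * r ^ n) = fun n => c * p.eval r * r ^ n := by
  ext n
  rw [aeval_seqShift_apply, eval_eq_sum_range, Finset.mul_sum, Finset.sum_mul]
  refine Finset.sum_congr rfl fun i _ => ?_
  ring

theorem tendsto_zero_of_succ_sub_mul_tendsto_zero {f : ℕ → ℂ} {z : ℂ} (hz : ‖z‖ < 1)
    (h : Tendsto (fun n => f (n + 1) - z * f n) atTop (𝓝 0)) : Tendsto f atTop (𝓝 0) := by
  rw [Metric.tendsto_atTop]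
  intro ε hε
  have hr : 0 < 1 - ‖z‖ := by linarith
  obtain ⟨N, hN⟩ := Metric.tendsto_atTop.1 h (ε / 2 * (1 - ‖z‖)) (by positivity)
  -- The error `ε / 2` is the fixed point of `t ↦ ‖z‖ * t + ε / 2 * (1 - ‖z‖)`.
  have key : ∀ k, ‖f (N + k)‖ ≤ ‖z‖ ^ k * ‖f N‖ + ε / 2 := by
    intro k
    induction k with
    | zero => simp; positivity
    | succ k ih =>
      have h1 := hN (N + k) (by omega)
      rw [dist_zero_right] at h1
      have h2 : f (N + (k + 1)) = (f (N + k + 1) - z * f (N + k)) + z * f (N + k) := by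
        rw [sub_add_cancel]; rfl
      have h3 := norm_add_le (f (N + k + 1) - z * f (N + k)) (z * f (N + k))
      rw [← h2, norm_mul] at h3
      have h4 := mul_le_mul_of_nonneg_left ih (norm_nonneg z)
      rw [pow_succ]
      nlinarith
  have hp : Tendsto (fun k => ‖z‖ ^ k * ‖f N‖) atTop (𝓝 (0 * ‖f N‖)) :=
    (tendsto_pow_atTop_nhds_zero_of_lt_one (norm_nonneg _) hz).mul_const _
  rw [zero_mul] at hp
  obtain ⟨K, hK⟩ := eventually_atTop.1 (hp.eventually_lt_const (half_pos hε))
  refine ⟨N + K, fun n hn => ?_⟩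
  obtain ⟨k, rfl⟩ := Nat.exists_eq_add_of_le hn
  rw [dist_zero_right, add_assoc]
  linarith [key (K + k), hK (K + k) (by omega)]

/-- Each root is peeled off by one first-order recurrence with a contracting multiplier, so no
closed form is needed and repeated roots cause no trouble. -/
theorem tendsto_zero_of_aeval_prod_X_sub_C (s : Multiset ℂ) (hs : ∀ z ∈ s, ‖z‖ < 1) (f : ℕ → ℂ)
    (h : aeval (seqShift ℂ) (s.map fun z => X - C z).prod f = 0) : Tendsto f atTop (𝓝 0) := by
  induction s using Multiset.induction generalizing f with
  | empty =>
    have : f = 0 := by simpa using h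
    rw [this]; exact tendsto_const_nhds
  | cons z s ih =>
    rw [Multiset.map_cons, Multiset.prod_cons, mul_comm, map_mul, Module.End.mul_apply] at h
    have h1 := ih (fun w hw => hs w (Multiset.mem_cons_of_mem hw)) _ h
    refine tendsto_zero_of_succ_sub_mul_tendsto_zero (hs z (Multiset.mem_cons_self z s)) ?_
    convert h1 using 2 with n
    simp [Algebra.algebraMap_eq_smul_one, seqShift_apply]

theorem tendsto_zero_of_aeval_seqShift_eq_zero {p : ℝ[X]} (hp : p.Monic)
    (hroots : ∀ z : ℂ, aeval z p = 0 → ‖z‖ < 1) {f : ℕ → ℝ}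
    (h : aeval (seqShift ℝ) p f = 0) : Tendsto f atTop (𝓝 0) := by
  have hq : (p.map (algebraMap ℝ ℂ)).Monic := hp.map _
  have hfac := (IsAlgClosed.splits (p.map (algebraMap ℝ ℂ))).eq_prod_roots_of_monic hq
  have h1 : aeval (seqShift ℂ) (p.map (algebraMap ℝ ℂ)) (fun n => (f n : ℂ)) = 0 := by
    ext n
    have h2 := congrFun h n
    rw [aeval_seqShift_apply] at h2 ⊢
    rw [natDegree_map]
    simp only [coeff_map, Complex.coe_algebraMap, Pi.zero_apply] at h2 ⊢
    exact_mod_cast h2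
  rw [hfac] at h1
  have h3 := tendsto_zero_of_aeval_prod_X_sub_C _ (fun z hz => hroots z ?_) _ h1
  · have := (Complex.continuous_re.tendsto 0).comp h3
    simpa [Function.comp_def] using this
  · rw [mem_roots hq.ne_zero, IsRoot, eval_map_algebraMap] at hz
    exact hz

/-! ### Solutions of the recurrence of a Pisot number -/

namespace IsPisot

variable {α : ℝ}

theorem map_minpoly_int (hα : IsPisot α) :
    (minpoly ℤ α).map (Int.castRingHom ℚ) = minpoly ℚ α :=
  (minpoly.isIntegrallyClosed_eq_field_fractions' ℚ hα.1).symm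

theorem natDegree_minpoly_int (hα : IsPisot α) :
    (minpoly ℤ α).natDegree = (minpoly ℚ α).natDegree := by
  rw [← hα.map_minpoly_int, (minpoly.monic hα.1).natDegree_map]

/-- Away from the dominant root, the minimal polynomial is a monic polynomial with all of its
complex roots in the open unit disc. -/
theorem exists_cofactor (hα : IsPisot α) :
    ∃ R : ℝ[X], R.Monic ∧ (minpoly ℤ α).map (Int.castRingHom ℝ) = (X - C α) * R ∧
      ∀ z : ℂ, aeval z R = 0 → ‖z‖ < 1 := by
  have hmonic : ((minpoly ℤ α).map (Int.castRingHom ℝ)).Monic := (minpoly.monic hα.1).map _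
  have hmap : (minpoly ℚ α).map (algebraMap ℚ ℝ) = (minpoly ℤ α).map (Int.castRingHom ℝ) := by
    rw [← hα.map_minpoly_int, Polynomial.map_map]
    congr 1
  have hroot : ((minpoly ℤ α).map (Int.castRingHom ℝ)).IsRoot α := by
    rw [← hmap, IsRoot, eval_map_algebraMap, minpoly.aeval]
  obtain ⟨R, hR⟩ := dvd_iff_isRoot.2 hroot
  have hint : IsIntegral ℚ α := hα.1.tower_top
  have hsep : ((minpoly ℚ α).map (algebraMap ℚ ℝ)).Separable :=
    (minpoly.irreducible hint).separable.map
  refine ⟨R, ?_, hR, fun z hz => ?_⟩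
  · rw [hR] at hmonic
    exact (monic_X_sub_C α).of_mul_monic_left hmonic
  · refine hα.2.2 z ?_ ?_
    · have h1 : aeval z ((minpoly ℚ α).map (algebraMap ℚ ℝ)) = 0 := by
        rw [hmap, hR, map_mul, hz, mul_zero]
      rwa [aeval_map_algebraMap] at h1
    · rintro rfl
      have h2 : R.eval α = 0 := by
        have : aeval ((algebraMap ℝ ℂ) α) R = 0 := hz
        rw [aeval_algebraMap_apply] at this
        simpa using this
      -- A second factor `X - C α` would contradict separability, so `α` is not a root of the
      -- cofactor.
      have h3 := hsep.squarefree
      rw [hmap, hR] at h3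
      have h4 : (X - C α) * (X - C α) ∣ (X - C α) * R :=
        mul_dvd_mul_left _ (dvd_iff_isRoot.2 h2)
      exact not_isUnit_X_sub_C α (h3 _ h4)

/-- Applying the cofactor `R` leaves a sequence multiplied by `α` at each step, hence geometric.
Subtracting `ξ α ^ n` with `ξ = v 0 / R(α)` gives a sequence killed by `R`, which decays. -/
theorem exists_tendsto_of_aeval_seqShift_eq_zero (hα : IsPisot α) {u : ℕ → ℝ}
    (hu : aeval (seqShift ℝ) ((minpoly ℤ α).map (Int.castRingHom ℝ)) u = 0) :
    ∃ ξ : ℝ, Tendsto (fun n => u n - ξ * α ^ n) atTop (𝓝 0) := by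
  obtain ⟨R, hR, hfac, hroots⟩ := hα.exists_cofactor
  have hRα : R.eval α ≠ 0 := by
    intro h
    have h1 := hroots (algebraMap ℝ ℂ α) (by rw [aeval_algebraMap_apply]; simp [h])
    rw [Complex.coe_algebraMap, Complex.norm_real, Real.norm_eq_abs, abs_lt] at h1
    linarith [hα.2.1]
  set v := aeval (seqShift ℝ) R u with hv
  have hv1 : ∀ n, v (n + 1) = α * v n := by
    intro n
    rw [hfac, map_mul, Module.End.mul_apply] at hu
    have := congrFun hu n
    simp only [map_sub, aeval_X, aeval_C, Algebra.algebraMap_eq_smul_one, LinearMap.sub_apply,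
      LinearMap.smul_apply, Module.End.one_apply, Pi.sub_apply, Pi.smul_apply, seqShift_apply,
      smul_eq_mul, Pi.zero_apply, ← hv] at this
    linarith
  have hv2 : v = fun n => v 0 * α ^ n := by
    ext n
    induction n with
    | zero => simp
    | succ n ih => rw [hv1, ih]; ring
  refine ⟨v 0 / R.eval α, tendsto_zero_of_aeval_seqShift_eq_zero hR hroots ?_⟩
  have : (fun n => u n - v 0 / R.eval α * α ^ n) = u - fun n => v 0 / R.eval α * α ^ n := rfl
  rw [this, map_sub, aeval_seqShift_geom, ← hv, div_mul_cancel₀ _ hRα, ← hv2, sub_self]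

end IsPisot

/-! ### Lower bounds from sequences sent to integers -/

/-- A solution of an inhomogeneous linear recurrence with zero initial data. -/
def recurrenceSolution (d : ℕ) (a t : ℕ → ℤ) (n : ℕ) : ℤ :=
  if _h : n < d then 0
  else t (n - d) - ∑ i : Fin d, a i * recurrenceSolution d a t (n - d + i)
termination_by n
decreasing_by have := i.2; omega

theorem exists_sum_coeff_mul_eq {p : ℤ[X]} (hp : p.Monic) (t : ℕ → ℤ) :
    ∃ s : ℕ → ℤ, ∀ n, ∑ i ∈ Finset.range (p.natDegree + 1), p.coeff i * s (n + i) = t n := by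
  refine ⟨recurrenceSolution p.natDegree p.coeff t, fun n => ?_⟩
  rw [Finset.sum_range_succ, hp.coeff_natDegree, one_mul,
    recurrenceSolution.eq_1 _ _ _ (n + p.natDegree), dif_neg (by omega), Nat.add_sub_cancel,
    Fin.sum_univ_eq_sum_range
      (fun i => p.coeff i * recurrenceSolution p.natDegree p.coeff t (n + i))]
  ring

/-- A real sequence that the minimal polynomial of `α` sends to integers gives a lower bound
for `L(α)`. -/
theorem IsPisot.le_pisotL {α : ℝ} (hα : IsPisot α) {y : ℕ → ℝ} {c : ℝ}
    (hint : ∀ n, ∃ k : ℤ,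
      aeval (seqShift ℝ) ((minpoly ℤ α).map (Int.castRingHom ℝ)) y n = k)
    (hc : ∀ n, c ≤ distNearestInt (y n)) : c ≤ pisotL α := by
  choose t ht using hint
  obtain ⟨s, hs⟩ := exists_sum_coeff_mul_eq (minpoly.monic hα.1) (fun n => -t n)
  have h0 : aeval (seqShift ℝ) ((minpoly ℤ α).map (Int.castRingHom ℝ))
      (y + fun n => (s n : ℝ)) = 0 := by
    ext n
    rw [map_add, Pi.add_apply, ht, aeval_seqShift_apply, (minpoly.monic hα.1).natDegree_map]
    have := congrArg (Int.cast (R := ℝ)) (hs n)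
    push_cast at this
    simp only [coeff_map, eq_intCast, Pi.zero_apply]
    linarith
  obtain ⟨ξ, hξ⟩ := hα.exists_tendsto_of_aeval_seqShift_eq_zero h0
  refine le_seqL_of_tendsto hξ fun n => ?_
  rw [Pi.add_apply, distNearestInt_add_int]
  exact hc n

theorem aeval_seqShift_re_geom (p : ℝ[X]) (z w : ℂ) :
    aeval (seqShift ℝ) p (fun n => (z * w ^ n).re) = fun n => (z * aeval w p * w ^ n).re := by
  ext n
  rw [aeval_seqShift_apply, aeval_eq_sum_range, Finset.mul_sum, Finset.sum_mul, Complex.re_sum]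
  refine Finset.sum_congr rfl fun i _ => ?_
  rw [← Complex.re_ofReal_mul, Complex.real_smul]
  congr 1
  ring

theorem Complex.I_pow_cases (n : ℕ) :
    Complex.I ^ n = 1 ∨ Complex.I ^ n = Complex.I ∨ Complex.I ^ n = -1 ∨
      Complex.I ^ n = -Complex.I := by
  induction n with
  | zero => simp
  | succ n ih => rcases ih with h | h | h | h <;> simp [pow_succ, h]

namespace IsPisot

variable {α : ℝ}

theorem eval_map_minpoly (x : ℤ) :
    ((minpoly ℤ α).map (Int.castRingHom ℝ)).eval (x : ℝ) = ((minpoly ℤ α).eval x : ℤ) := by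
  rw [← eq_intCast (Int.castRingHom ℝ) x, eval_map, eval₂_at_apply, eq_intCast]

/-- Lower bound for `L(α)` from a geometric progression modulo a divisor of a value of the
minimal polynomial. -/
theorem le_pisotL_of_geom (hα : IsPisot α) {q g r : ℤ} (c : ℤ) (hq : 0 < q)
    (hdvd : q ∣ (minpoly ℤ α).eval g)
    (hr : ∀ n : ℕ, r ≤ c * g ^ n % q ∧ c * g ^ n % q ≤ q - r) : (r : ℝ) / q ≤ pisotL α := by
  have hq' : (0 : ℝ) < q := by exact_mod_cast hq
  refine hα.le_pisotL (y := fun n => (c : ℝ) / q * (g : ℝ) ^ n) (fun n => ?_) fun n => ?_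
  · obtain ⟨k, hk⟩ := hdvd
    rw [aeval_seqShift_geom, eval_map_minpoly, hk]
    refine ⟨c * k * g ^ n, ?_⟩
    push_cast
    field_simp
  · obtain ⟨h1, h2⟩ := hr n
    have h3 : ((c * g ^ n : ℤ) : ℝ) = q * (c * g ^ n / q : ℤ) + (c * g ^ n % q : ℤ) := by
      exact_mod_cast (Int.mul_ediv_add_emod (c * g ^ n) q).symm
    have h4 : (c : ℝ) / q * (g : ℝ) ^ n = (c * g ^ n / q : ℤ) + (c * g ^ n % q : ℤ) / (q : ℝ) := by
      field_simp
      push_cast at h3 ⊢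
      linarith
    rw [h4]
    have h1' : (r : ℝ) ≤ (c * g ^ n % q : ℤ) := by exact_mod_cast h1
    have h2' : ((c * g ^ n % q : ℤ) : ℝ) ≤ q - r := by exact_mod_cast h2
    apply le_distNearestInt (c * g ^ n / q)
    · gcongr
    · have : ((c * g ^ n % q : ℤ) : ℝ) / q ≤ (q - r) / q := by gcongr
      rw [sub_div, div_self hq'.ne'] at this
      linarith

/-- Modulo `q` the orbit of `⌊q / 2⌋` under `±1` stays at distance `⌊q / 2⌋` from multiples of `q`.
The ratio `⌊q / 2⌋ / q` is least at `q = 3`. -/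
theorem third_le_pisotL_of_sq_eq_one (hα : IsPisot α) {g : ℤ} (hg : g ^ 2 = 1)
    (h : 2 ≤ |(minpoly ℤ α).eval g|) : 1 / 3 ≤ pisotL α := by
  set q := |(minpoly ℤ α).eval g| with hq
  have hq2 : (2 : ℝ) ≤ q := by exact_mod_cast h
  have key : ((q / 2 : ℤ) : ℝ) / (q : ℤ) ≤ pisotL α := by
    refine hα.le_pisotL_of_geom (g := g) (q / 2) (by omega) (abs_dvd_self _) fun n => ?_
    have hgn : g ^ n = 1 ∨ g ^ n = -1 := by
      have h1 : (g ^ n) ^ 2 = 1 := by rw [← pow_mul, mul_comm, pow_mul, hg, one_pow]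
      rwa [sq, mul_self_eq_one_iff] at h1
    rcases hgn with h1 | h1 <;> rw [h1]
    · rw [mul_one, Int.emod_eq_of_lt (by omega) (by omega)]
      omega
    · rw [← Int.add_emod_right, Int.emod_eq_of_lt (by omega) (by omega)]
      omega
  refine le_trans ?_ key
  rw [div_le_div_iff₀ (by norm_num) (by linarith)]
  have : q ≤ 3 * (q / 2) := by omega
  have : (q : ℝ) ≤ 3 * (q / 2 : ℤ) := by exact_mod_cast this
  linarith

/-- Lower bound for `L(α)` from a sequence of period four around `1 / 2`, governed by the value
of the minimal polynomial at `i`. -/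
theorem le_pisotL_of_aeval_I (hα : IsPisot α) {A B : ℤ} {c : ℝ}
    (h1 : (minpoly ℤ α).eval 1 = -1) (hI : aeval Complex.I (minpoly ℤ α) = A + B * Complex.I)
    (hN : 0 < A ^ 2 + B ^ 2)
    (hc : |(A : ℝ)| + |(B : ℝ)| ≤ (1 - 2 * c) * (A ^ 2 + B ^ 2)) : c ≤ pisotL α := by
  have hN' : (0 : ℝ) < A ^ 2 + B ^ 2 := by exact_mod_cast hN
  have hNC : ((A : ℂ) ^ 2 + B ^ 2) ≠ 0 := by exact_mod_cast hN'.ne'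
  -- `a` and `b` are the real and imaginary parts of `(1 + i) / (2 * (A + B * i))`.
  set a : ℝ := (A + B) / (2 * (A ^ 2 + B ^ 2)) with ha
  set b : ℝ := (A - B) / (2 * (A ^ 2 + B ^ 2)) with hb
  set z : ℂ := a + b * Complex.I with hz
  have hzI : z * aeval Complex.I ((minpoly ℤ α).map (Int.castRingHom ℝ)) =
      (1 + Complex.I) / 2 := by
    have : aeval Complex.I ((minpoly ℤ α).map (Int.castRingHom ℝ)) =
        aeval Complex.I (minpoly ℤ α) := aeval_map_algebraMap ℝ Complex.I (minpoly ℤ α)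
    rw [this, hI, hz, ha, hb]
    push_cast
    field_simp
    linear_combination (A - B : ℂ) * B * Complex.I_sq
  have ha1 : |a| ≤ 1 / 2 - c := by
    rw [ha, abs_div, abs_of_pos (by linarith : (0 : ℝ) < 2 * (A ^ 2 + B ^ 2)),
      div_le_iff₀ (by linarith)]
    linarith [abs_add_le (A : ℝ) B]
  have hb1 : |b| ≤ 1 / 2 - c := by
    rw [hb, abs_div, abs_of_pos (by linarith : (0 : ℝ) < 2 * (A ^ 2 + B ^ 2)),
      div_le_iff₀ (by linarith)]
    linarith [norm_sub_le (A : ℝ) B, Real.norm_eq_abs (A : ℝ), Real.norm_eq_abs (B : ℝ),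
      Real.norm_eq_abs (A - B : ℝ)]
  have ha2 := abs_le.1 ha1
  have hb2 := abs_le.1 hb1
  refine hα.le_pisotL
    (y := (fun n => 1 / 2 * (1 : ℝ) ^ n) + fun n => (z * Complex.I ^ n).re)
    (fun n => ?_) fun n => ?_
  · have he := eval_map_minpoly (α := α) 1
    rw [h1] at he
    push_cast at he
    rw [map_add, aeval_seqShift_geom, aeval_seqShift_re_geom, hzI, he]
    -- The constant `1/2` contributes `P(1) / 2 = -1/2` and the periodic part `Re ((1 + i) / 2 * i ^
    -- n) = ±1/2`.
    rcases Complex.I_pow_cases n with h | h | h | h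
    · exact ⟨0, by simp [h]⟩
    · exact ⟨-1, by simp [h]; norm_num⟩
    · exact ⟨-1, by simp [h]; norm_num⟩
    · exact ⟨0, by simp [h]⟩
  · apply le_distNearestInt 0 <;>
      rcases Complex.I_pow_cases n with h | h | h | h <;>
      simp [h, hz] <;> linarith [ha2.1, ha2.2, hb2.1, hb2.2]

/-! ### Sign and size constraints on the minimal polynomial -/

theorem eval_one_neg (hα : IsPisot α) : (minpoly ℤ α).eval 1 < 0 := by
  obtain ⟨R, hR, hfac, hroots⟩ := hα.exists_cofactor
  have h1 : 0 < R.eval 1 := by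
    refine zero_lt_eval_of_roots_lt_of_leadingCoeff_nonneg (fun x hx => ?_) (by simp [hR])
    have h2 := hroots (algebraMap ℝ ℂ x) (by
      rw [aeval_algebraMap_apply, coe_aeval_eq_eval, hx.eq_zero, map_zero])
    rw [Complex.coe_algebraMap, Complex.norm_real] at h2
    exact (abs_lt.1 h2).2
  have h3 := eval_map_minpoly (α := α) 1
  rw [hfac, eval_mul] at h3
  simp only [Int.cast_one, eval_sub, eval_X, eval_C] at h3
  have h4 : (((minpoly ℤ α).eval 1 : ℤ) : ℝ) < 0 := by
    rw [← h3]
    exact mul_neg_of_neg_of_pos (by linarith [hα.2.1]) h1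
  exact_mod_cast h4

/-- The polynomial `(-1) ^ d * P(-x)` is monic and its real roots are `-α` or of modulus below `1`,
so it is positive at `1`. -/
theorem eval_neg_one_pos (hα : IsPisot α) :
    0 < (-1) ^ (minpoly ℤ α).natDegree * (minpoly ℤ α).eval (-1) := by
  have hM : ((minpoly ℤ α).map (Int.castRingHom ℝ)).Monic := (minpoly.monic hα.1).map _
  obtain ⟨R, hR, hfac, hroots⟩ := hα.exists_cofactor
  have h1 : 0 < (C ((-1) ^ (minpoly ℤ α).natDegree) *
      ((minpoly ℤ α).map (Int.castRingHom ℝ)).comp (-X)).eval 1 := by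
    refine zero_lt_eval_of_roots_lt_of_leadingCoeff_nonneg (fun x hx => ?_) ?_
    · have h2 : ((minpoly ℤ α).map (Int.castRingHom ℝ)).eval (-x) = 0 := by
        simpa [IsRoot] using hx
      rw [hfac, eval_mul, mul_eq_zero] at h2
      rcases h2 with h2 | h2
      · simp at h2
        linarith [hα.2.1]
      · have h3 := hroots (algebraMap ℝ ℂ (-x)) (by
          rw [aeval_algebraMap_apply, coe_aeval_eq_eval, h2, map_zero])
        rw [Complex.coe_algebraMap, Complex.norm_real, norm_neg] at h3
        exact (abs_lt.1 h3).2
    · rw [leadingCoeff_mul, leadingCoeff_C, leadingCoeff_comp (by simp), hM.leadingCoeff,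
        (minpoly.monic hα.1).natDegree_map, leadingCoeff_neg, leadingCoeff_X, one_mul, ← mul_pow]
      norm_num
  have h3 := eval_map_minpoly (α := α) (-1)
  simp only [eval_mul, eval_C, eval_comp, eval_neg, eval_X] at h1
  push_cast at h3
  rw [h3] at h1
  exact_mod_cast h1

theorem abs_coeff_zero_le (hα : IsPisot α) : |((minpoly ℤ α).coeff 0 : ℝ)| ≤ α := by
  obtain ⟨R, hR, hfac, hroots⟩ := hα.exists_cofactor
  have h0 : ((minpoly ℤ α).coeff 0 : ℝ) = -α * R.coeff 0 := by
    have := congrArg (fun p => p.coeff 0) hfac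
    simpa [mul_coeff_zero] using this
  have hq : (R.map (algebraMap ℝ ℂ)).Monic := hR.map _
  have h1 := (IsAlgClosed.splits (R.map (algebraMap ℝ ℂ))).coeff_zero_eq_prod_roots_of_monic hq
  have h2 : ‖(R.map (algebraMap ℝ ℂ)).coeff 0‖ ≤ 1 := by
    rw [h1, norm_mul, norm_pow, norm_neg, norm_one, one_pow, one_mul]
    refine Multiset.prod_induction (fun w => ‖w‖ ≤ 1) _ (fun w w' hw hw' => ?_) (by simp)
      fun z hz => (hroots z ?_).le
    · rw [norm_mul]
      exact mul_le_one₀ hw (norm_nonneg _) hw'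
    · rw [mem_roots hq.ne_zero, IsRoot, eval_map_algebraMap] at hz
      exact hz
  rw [coeff_map, Complex.coe_algebraMap, Complex.norm_real, Real.norm_eq_abs] at h2
  rw [h0, abs_mul, abs_neg, abs_of_pos (by linarith [hα.2.1])]
  nlinarith [hα.2.1]

end IsPisot

/-! ### Upper bounds by finite sign patterns -/

/-- If no power sequence of `α` can stay centrally within `1 / 2 - c` of the half-integers,
then `L(α) ≤ c`. -/
theorem pisotL_le_of_forall_not {α c : ℝ}
    (h : ∀ (x y : ℕ → ℝ) (s : ℕ → ℤ), (∀ n, |y n| < 1 / 2 - c) →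
      (∀ n, x n = s n + y n + 1 / 2) → (∀ n, x (n + 1) = α * x n) → False) :
    pisotL α ≤ c := by
  refine seqL_le_of_forall_not fun ξ N => ?_
  by_contra! hlt
  refine h (fun n => ξ * α ^ (N + n)) (fun n => Int.fract (ξ * α ^ (N + n)) - 1 / 2)
    (fun n => ⌊ξ * α ^ (N + n)⌋) (fun n => abs_fract_sub_half_lt (hlt _ (by omega)))
    (fun n => ?_) fun n => ?_
  · linarith [Int.floor_add_fract (ξ * α ^ (N + n))]
  · ring

theorem Int.eq_zero_or_eq_neg_one_of_abs_add_half_lt {k : ℤ} {u : ℝ} (hu : u = k + 1 / 2)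
    (h : |u| < 1) : u = 1 / 2 ∨ u = -1 / 2 := by
  rw [abs_lt, hu] at h
  have h1 : (-2 : ℝ) < k := by linarith
  have h2 : (k : ℝ) < 1 := by linarith
  have h1' : -2 < k := by exact_mod_cast h1
  have h2' : k < 1 := by exact_mod_cast h2
  rcases (by omega : k = 0 ∨ k = -1) with rfl | rfl
  · left; rw [hu]; norm_num
  · right; rw [hu]; norm_num

theorem pisotL_le_of_golden {α : ℝ} (hα : α ^ 2 - α - 1 = 0) : pisotL α ≤ 1 / 5 := by
  refine pisotL_le_of_forall_not fun x y s hy hx hrec => ?_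
  have hb := fun n => abs_lt.1 (hy n)
  norm_num at hb
  -- The recurrence has coefficients of total modulus `3`, and `3 * (3 / 10) < 1`.
  have H : ∀ n, y (n + 2) - y (n + 1) - y n = 1 / 2 ∨ y (n + 2) - y (n + 1) - y n = -1 / 2 := by
    intro n
    refine Int.eq_zero_or_eq_neg_one_of_abs_add_half_lt (k := s (n + 1) + s n - s (n + 2)) ?_ ?_
    · have h1 : x (n + 2) - x (n + 1) - x n = 0 := by
        rw [hrec (n + 1), hrec n]; linear_combination hα * x n
      rw [hx, hx, hx] at h1
      push_cast
      linarith
    · rw [abs_lt]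
      constructor <;> linarith [hb n, hb (n + 1), hb (n + 2)]
  have b0 := hb 0
  have b1 := hb 1
  have b2 := hb 2
  have b3 := hb 3
  have b4 := hb 4
  have b5 := hb 5
  -- Four consecutive signs already make the bounds on `y 0, …, y 5` infeasible.
  rcases H 0 with h0 | h0 <;> rcases H 1 with h1 | h1 <;> rcases H 2 with h2 | h2 <;>
    rcases H 3 with h3 | h3 <;> norm_num at h0 h1 h2 h3 <;> linarith

theorem pisotL_le_of_plastic {α : ℝ} (hα : α ^ 3 - α - 1 = 0) : pisotL α ≤ 1 / 5 := by
  refine pisotL_le_of_forall_not fun x y s hy hx hrec => ?_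
  have hb := fun n => abs_lt.1 (hy n)
  norm_num at hb
  have H : ∀ n, y (n + 3) - y (n + 1) - y n = 1 / 2 ∨ y (n + 3) - y (n + 1) - y n = -1 / 2 := by
    intro n
    refine Int.eq_zero_or_eq_neg_one_of_abs_add_half_lt (k := s (n + 1) + s n - s (n + 3)) ?_ ?_
    · have h1 : x (n + 3) - x (n + 1) - x n = 0 := by
        rw [hrec (n + 2), hrec (n + 1), hrec n]; linear_combination hα * x n
      rw [hx, hx, hx] at h1
      push_cast
      linarith
    · rw [abs_lt]
      constructor <;> linarith [hb n, hb (n + 1), hb (n + 3)]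
  have b0 := hb 0
  have b1 := hb 1
  have b2 := hb 2
  have b3 := hb 3
  have b4 := hb 4
  have b5 := hb 5
  have b6 := hb 6
  have b7 := hb 7
  rcases H 0 with h0 | h0 <;> rcases H 1 with h1 | h1 <;> rcases H 2 with h2 | h2 <;>
    rcases H 3 with h3 | h3 <;> norm_num at h0 h1 h2 h3 <;> first
    | linarith
    | (rcases H 4 with h4 | h4 <;> norm_num at h4 <;> linarith)

theorem pisotL_le_of_cubic {α : ℝ} (hα : α ^ 3 - 2 * α ^ 2 - α + 1 = 0) :
    pisotL α ≤ 4 / 13 := by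
  refine pisotL_le_of_forall_not fun x y s hy hx hrec => ?_
  have hb := fun n => abs_lt.1 (hy n)
  norm_num at hb
  have H : ∀ n, y (n + 3) - 2 * y (n + 2) - y (n + 1) + y n = 1 / 2 ∨
      y (n + 3) - 2 * y (n + 2) - y (n + 1) + y n = -1 / 2 := by
    intro n
    refine Int.eq_zero_or_eq_neg_one_of_abs_add_half_lt
      (k := 2 * s (n + 2) + s (n + 1) - s n - s (n + 3)) ?_ ?_
    · have h1 : x (n + 3) - 2 * x (n + 2) - x (n + 1) + x n = 0 := by
        rw [hrec (n + 2), hrec (n + 1), hrec n]; linear_combination hα * x n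
      rw [hx, hx, hx, hx] at h1
      push_cast
      linarith
    · rw [abs_lt]
      constructor <;> linarith [hb n, hb (n + 1), hb (n + 2), hb (n + 3)]
  have b0 := hb 0
  have b1 := hb 1
  have b2 := hb 2
  have b3 := hb 3
  have b4 := hb 4
  have b5 := hb 5
  have b6 := hb 6
  have b7 := hb 7
  rcases H 0 with h0 | h0 <;> rcases H 1 with h1 | h1 <;> rcases H 2 with h2 | h2 <;>
    rcases H 3 with h3 | h3 <;> norm_num at h0 h1 h2 h3 <;> first
    | linarith
    | (rcases H 4 with h4 | h4 <;> norm_num at h4 <;> linarith)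

/-! ### Forbidden words for the quartic -/

/-- `Spells s n f` says that the word `f` occurs in the binary sequence `s` at position `n`. -/
def Spells (s : ℕ → Bool) : ℕ → List Bool → Prop
  | _, [] => True
  | n, b :: f => s n = b ∧ Spells s (n + 1) f

theorem spells_of_isPrefix {s : ℕ → Bool} {f w : List Bool} {n : ℕ} (h : f <+: w)
    (hw : Spells s n w) : Spells s n f := by
  induction f generalizing w n with
  | nil => trivial
  | cons b f ih =>
    cases w with
    | nil => simp at h
    | cons b' w =>
      obtain ⟨rfl, hf⟩ := List.cons_prefix_cons.1 h
      exact ⟨hw.1, ih hf hw.2⟩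

/-- Whether the word `w` can be extended by `k` letters to the left without creating a
prefix from the list `F`. -/
def extendable (F : List (List Bool)) : ℕ → List Bool → Bool
  | 0, _ => true
  | k + 1, w => [true, false].any fun b =>
      !(F.any fun f => f.isPrefixOf (b :: w)) && extendable F k (b :: w)

theorem extendable_of_forall_not_spells {F : List (List Bool)} {s : ℕ → Bool}
    (h : ∀ n, ∀ f ∈ F, ¬ Spells s n f) {k : ℕ} {w : List Bool} (hw : Spells s k w) :
    extendable F k w = true := by
  induction k generalizing w with
  | zero => rfl
  | succ k ih =>
    have hw' : Spells s k (s k :: w) := ⟨rfl, hw⟩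
    rw [extendable, List.any_eq_true]
    refine ⟨s k, by cases s k <;> simp, ?_⟩
    rw [ih hw', Bool.and_true, Bool.not_eq_true', List.any_eq_false]
    intro f hf hpre
    exact h k f hf (spells_of_isPrefix (List.isPrefixOf_iff_prefix.1 hpre) hw')

theorem spells_map_not {s : ℕ → Bool} {f : List Bool} {n : ℕ} (h : Spells s n (f.map not)) :
    Spells (fun k => !s k) n f := by
  induction f generalizing n with
  | nil => trivial
  | cons b f ih => exact ⟨by simp [h.1], ih h.2⟩

/-- Words which, up to a global sign change, cannot occur in the sign sequence of a small
solution of `y (n + 4) - y (n + 3) - y n = ± 1 / 2`. -/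
def quarticForbidden : List (List Bool) :=
  [[true, false, false, false],
    [true, true, true, false],
    [true, true, true, true],
    [true, true, false, false],
    [true, false, true, false, true, true],
    [true, false, true, false, true, false, true],
    [true, false, true, false, false, true, false, false],
    [true, true, false, true, true, false, true, false, false],
    [true, false, true, false, false, true, false, true, false],
    [true, true, false, true, true, false, true, false, true],
    [true, true, false, true, true, false, true, true, false, true, true],
    [true, false, true, false, false, true, false, true, true, false, true, false, false]]

/-- Every binary word of length `16` contains a forbidden word or a complement of one. Growing words
leftwards means that only prefixes need testing. -/
theorem not_extendable_quarticForbidden :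
    extendable (quarticForbidden ++ quarticForbidden.map (List.map not)) 16 [] = false := by
  decide +kernel

theorem not_spells_quarticForbidden {y : ℕ → ℝ} {s : ℕ → Bool}
    (hy : ∀ n, -(11 / 34) < y n ∧ y n < 11 / 34)
    (hs : ∀ n, y (n + 4) - y (n + 3) - y n = if s n then 1 / 2 else -1 / 2) (n : ℕ) :
    ∀ f ∈ quarticForbidden, ¬ Spells s n f := by
  have step : ∀ n b, s n = b →
      y (n + 4) - y (n + 3) - y n = if b then 1 / 2 else -1 / 2 := by
    rintro n b rfl; exact hs n
  have lo := fun k => (hy k).1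
  have hi := fun k => (hy k).2
  simp only [quarticForbidden, List.forall_mem_cons, List.not_mem_nil, false_imp_iff,
    implies_true, and_true]
  refine ⟨?_, ?_, ?_, ?_, ?_, ?_, ?_, ?_, ?_, ?_, ?_, ?_⟩
  · rintro ⟨h0, h1, h2, h3, -⟩
    have e0 := step n _ h0
    have e1 := step _ _ h1
    have e2 := step _ _ h2
    have e3 := step _ _ h3
    simp only [add_assoc, Nat.reduceAdd, if_true, Bool.false_eq_true, if_false] at e0 e1 e2 e3
    linarith [lo n, lo (n + 1), lo (n + 2), lo (n + 3), lo (n + 4), lo (n + 5), lo (n + 6),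
      lo (n + 7), hi n, hi (n + 1), hi (n + 2), hi (n + 3), hi (n + 4), hi (n + 5), hi (n + 6),
      hi (n + 7)]
  · rintro ⟨h0, h1, h2, h3, -⟩
    have e0 := step n _ h0
    have e1 := step _ _ h1
    have e2 := step _ _ h2
    have e3 := step _ _ h3
    simp only [add_assoc, Nat.reduceAdd, if_true, Bool.false_eq_true, if_false] at e0 e1 e2 e3
    linarith [lo n, lo (n + 1), lo (n + 2), lo (n + 3), lo (n + 4), lo (n + 5), lo (n + 6),
      lo (n + 7), hi n, hi (n + 1), hi (n + 2), hi (n + 3), hi (n + 4), hi (n + 5), hi (n + 6),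
      hi (n + 7)]
  · rintro ⟨h0, h1, h2, h3, -⟩
    have e0 := step n _ h0
    have e1 := step _ _ h1
    have e2 := step _ _ h2
    have e3 := step _ _ h3
    simp only [add_assoc, Nat.reduceAdd, if_true] at e0 e1 e2 e3
    linarith [lo n, lo (n + 1), lo (n + 2), lo (n + 3), lo (n + 4), lo (n + 5), lo (n + 6),
      lo (n + 7), hi n, hi (n + 1), hi (n + 2), hi (n + 3), hi (n + 4), hi (n + 5), hi (n + 6),
      hi (n + 7)]
  · rintro ⟨h0, h1, h2, h3, -⟩
    have e0 := step n _ h0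
    have e1 := step _ _ h1
    have e2 := step _ _ h2
    have e3 := step _ _ h3
    simp only [add_assoc, Nat.reduceAdd, if_true, Bool.false_eq_true, if_false] at e0 e1 e2 e3
    linarith [lo n, lo (n + 1), lo (n + 2), lo (n + 3), lo (n + 4), lo (n + 5), lo (n + 6),
      lo (n + 7), hi n, hi (n + 1), hi (n + 2), hi (n + 3), hi (n + 4), hi (n + 5), hi (n + 6),
      hi (n + 7)]
  · rintro ⟨h0, h1, h2, h3, h4, h5, -⟩
    have e0 := step n _ h0
    have e1 := step _ _ h1
    have e2 := step _ _ h2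
    have e3 := step _ _ h3
    have e4 := step _ _ h4
    have e5 := step _ _ h5
    simp only [add_assoc, Nat.reduceAdd, if_true, Bool.false_eq_true, if_false] at e0 e1 e2 e3 e4 e5
    linarith [lo n, lo (n + 1), lo (n + 2), lo (n + 3), lo (n + 4), lo (n + 5), lo (n + 6),
      lo (n + 7), lo (n + 8), lo (n + 9), hi n, hi (n + 1), hi (n + 2), hi (n + 3), hi (n + 4),
      hi (n + 5), hi (n + 6), hi (n + 7), hi (n + 8), hi (n + 9)]
  · rintro ⟨h0, h1, h2, h3, h4, h5, h6, -⟩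
    have e0 := step n _ h0
    have e1 := step _ _ h1
    have e2 := step _ _ h2
    have e3 := step _ _ h3
    have e4 := step _ _ h4
    have e5 := step _ _ h5
    have e6 := step _ _ h6
    simp only [add_assoc, Nat.reduceAdd, if_true, Bool.false_eq_true, if_false] at e0 e1 e2 e3 e4 e5 e6
    linarith [lo n, lo (n + 1), lo (n + 2), lo (n + 3), lo (n + 4), lo (n + 5), lo (n + 6),
      lo (n + 7), lo (n + 8), lo (n + 9), lo (n + 10), hi n, hi (n + 1), hi (n + 2), hi (n + 3),
      hi (n + 4), hi (n + 5), hi (n + 6), hi (n + 7), hi (n + 8), hi (n + 9), hi (n + 10)]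
  · rintro ⟨h0, h1, h2, h3, h4, h5, h6, h7, -⟩
    have e0 := step n _ h0
    have e1 := step _ _ h1
    have e2 := step _ _ h2
    have e3 := step _ _ h3
    have e4 := step _ _ h4
    have e5 := step _ _ h5
    have e6 := step _ _ h6
    have e7 := step _ _ h7
    simp only [add_assoc, Nat.reduceAdd, if_true, Bool.false_eq_true, if_false] at e0 e1 e2 e3 e4 e5 e6 e7
    linarith [lo n, lo (n + 1), lo (n + 2), lo (n + 3), lo (n + 4), lo (n + 5), lo (n + 6),
      lo (n + 7), lo (n + 8), lo (n + 9), lo (n + 10), lo (n + 11), hi n, hi (n + 1), hi (n + 2),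
      hi (n + 3), hi (n + 4), hi (n + 5), hi (n + 6), hi (n + 7), hi (n + 8), hi (n + 9),
      hi (n + 10), hi (n + 11)]
  · rintro ⟨h0, h1, h2, h3, h4, h5, h6, h7, h8, -⟩
    have e0 := step n _ h0
    have e1 := step _ _ h1
    have e2 := step _ _ h2
    have e3 := step _ _ h3
    have e4 := step _ _ h4
    have e5 := step _ _ h5
    have e6 := step _ _ h6
    have e7 := step _ _ h7
    have e8 := step _ _ h8
    simp only [add_assoc, Nat.reduceAdd, if_true, Bool.false_eq_true, if_false] at e0 e1 e2 e3 e4 e5 e6 e7 e8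
    linarith [lo n, lo (n + 1), lo (n + 2), lo (n + 3), lo (n + 4), lo (n + 5), lo (n + 6),
      lo (n + 7), lo (n + 8), lo (n + 9), lo (n + 10), lo (n + 11), lo (n + 12), hi n,
      hi (n + 1), hi (n + 2), hi (n + 3), hi (n + 4), hi (n + 5), hi (n + 6), hi (n + 7),
      hi (n + 8), hi (n + 9), hi (n + 10), hi (n + 11), hi (n + 12)]
  · rintro ⟨h0, h1, h2, h3, h4, h5, h6, h7, h8, -⟩
    have e0 := step n _ h0
    have e1 := step _ _ h1
    have e2 := step _ _ h2
    have e3 := step _ _ h3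
    have e4 := step _ _ h4
    have e5 := step _ _ h5
    have e6 := step _ _ h6
    have e7 := step _ _ h7
    have e8 := step _ _ h8
    simp only [add_assoc, Nat.reduceAdd, if_true, Bool.false_eq_true, if_false] at e0 e1 e2 e3 e4 e5 e6 e7 e8
    linarith [lo n, lo (n + 1), lo (n + 2), lo (n + 3), lo (n + 4), lo (n + 5), lo (n + 6),
      lo (n + 7), lo (n + 8), lo (n + 9), lo (n + 10), lo (n + 11), lo (n + 12), hi n,
      hi (n + 1), hi (n + 2), hi (n + 3), hi (n + 4), hi (n + 5), hi (n + 6), hi (n + 7),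
      hi (n + 8), hi (n + 9), hi (n + 10), hi (n + 11), hi (n + 12)]
  · rintro ⟨h0, h1, h2, h3, h4, h5, h6, h7, h8, -⟩
    have e0 := step n _ h0
    have e1 := step _ _ h1
    have e2 := step _ _ h2
    have e3 := step _ _ h3
    have e4 := step _ _ h4
    have e5 := step _ _ h5
    have e6 := step _ _ h6
    have e7 := step _ _ h7
    have e8 := step _ _ h8
    simp only [add_assoc, Nat.reduceAdd, if_true, Bool.false_eq_true, if_false] at e0 e1 e2 e3 e4 e5 e6 e7 e8
    linarith [lo n, lo (n + 1), lo (n + 2), lo (n + 3), lo (n + 4), lo (n + 5), lo (n + 6),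
      lo (n + 7), lo (n + 8), lo (n + 9), lo (n + 10), lo (n + 11), lo (n + 12), hi n,
      hi (n + 1), hi (n + 2), hi (n + 3), hi (n + 4), hi (n + 5), hi (n + 6), hi (n + 7),
      hi (n + 8), hi (n + 9), hi (n + 10), hi (n + 11), hi (n + 12)]
  · rintro ⟨h0, h1, h2, h3, h4, h5, h6, h7, h8, h9, h10, -⟩
    have e0 := step n _ h0
    have e1 := step _ _ h1
    have e2 := step _ _ h2
    have e3 := step _ _ h3
    have e4 := step _ _ h4
    have e5 := step _ _ h5
    have e6 := step _ _ h6
    have e7 := step _ _ h7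
    have e8 := step _ _ h8
    have e9 := step _ _ h9
    have e10 := step _ _ h10
    simp only [add_assoc, Nat.reduceAdd, if_true, Bool.false_eq_true, if_false] at e0 e1 e2 e3 e4 e5 e6 e7 e8 e9 e10
    linarith [lo n, lo (n + 1), lo (n + 2), lo (n + 3), lo (n + 4), lo (n + 5), lo (n + 6),
      lo (n + 7), lo (n + 8), lo (n + 9), lo (n + 10), lo (n + 11), lo (n + 12), lo (n + 13),
      lo (n + 14), hi n, hi (n + 1), hi (n + 2), hi (n + 3), hi (n + 4), hi (n + 5), hi (n + 6),
      hi (n + 7), hi (n + 8), hi (n + 9), hi (n + 10), hi (n + 11), hi (n + 12), hi (n + 13),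
      hi (n + 14)]
  · rintro ⟨h0, h1, h2, h3, h4, h5, h6, h7, h8, h9, h10, h11, h12, -⟩
    have e0 := step n _ h0
    have e1 := step _ _ h1
    have e2 := step _ _ h2
    have e3 := step _ _ h3
    have e4 := step _ _ h4
    have e5 := step _ _ h5
    have e6 := step _ _ h6
    have e7 := step _ _ h7
    have e8 := step _ _ h8
    have e9 := step _ _ h9
    have e10 := step _ _ h10
    have e11 := step _ _ h11
    have e12 := step _ _ h12
    simp only [add_assoc, Nat.reduceAdd, if_true, Bool.false_eq_true, if_false] at e0 e1 e2 e3 e4 e5 e6 e7 e8 e9 e10 e11 e12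
    linarith [lo n, lo (n + 1), lo (n + 2), lo (n + 3), lo (n + 4), lo (n + 5), lo (n + 6),
      lo (n + 7), lo (n + 8), lo (n + 9), lo (n + 10), lo (n + 11), lo (n + 12), lo (n + 13),
      lo (n + 14), lo (n + 15), lo (n + 16), hi n, hi (n + 1), hi (n + 2), hi (n + 3),
      hi (n + 4), hi (n + 5), hi (n + 6), hi (n + 7), hi (n + 8), hi (n + 9), hi (n + 10),
      hi (n + 11), hi (n + 12), hi (n + 13), hi (n + 14), hi (n + 15), hi (n + 16)]

theorem pisotL_le_of_quartic {α : ℝ} (hα : α ^ 4 - α ^ 3 - 1 = 0) : pisotL α ≤ 3 / 17 := by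
  refine pisotL_le_of_forall_not fun x y s hy hx hrec => ?_
  have hb := fun n => abs_lt.1 (hy n)
  norm_num at hb
  have H : ∀ n, y (n + 4) - y (n + 3) - y n = 1 / 2 ∨ y (n + 4) - y (n + 3) - y n = -1 / 2 := by
    intro n
    refine Int.eq_zero_or_eq_neg_one_of_abs_add_half_lt (k := s (n + 3) + s n - s (n + 4)) ?_ ?_
    · have h1 : x (n + 4) - x (n + 3) - x n = 0 := by
        rw [hrec (n + 3), hrec (n + 2), hrec (n + 1), hrec n]; linear_combination hα * x n
      rw [hx, hx, hx] at h1
      push_cast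
      linarith
    · rw [abs_lt]
      constructor <;> linarith [hb n, hb (n + 3), hb (n + 4)]
  have hw : ∀ n, ∃ b : Bool, y (n + 4) - y (n + 3) - y n = if b then 1 / 2 else -1 / 2 := by
    intro n
    rcases H n with h | h
    · exact ⟨true, by simpa using h⟩
    · exact ⟨false, by simpa using h⟩
  choose w hw using hw
  have key : ∀ n, ∀ f ∈ quarticForbidden ++ quarticForbidden.map (List.map not),
      ¬ Spells w n f := by
    intro n f hf
    rw [List.mem_append, List.mem_map] at hf
    rcases hf with hf | ⟨f, hf, rfl⟩
    · exact not_spells_quarticForbidden hb hw n f hf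
    · intro hsp
      -- Negating `y` flips all signs, which handles the complementary words.
      refine not_spells_quarticForbidden (y := fun n => -y n) (fun n => ?_) (fun n => ?_) n f hf
        (spells_map_not hsp)
      · constructor <;> linarith [hb n]
      · have := hw n
        cases h : w n <;> simp [h] at this ⊢ <;> linarith
  have h16 := extendable_of_forall_not_spells key (k := 16) (w := []) trivial
  rw [not_extendable_quarticForbidden] at h16
  exact Bool.false_ne_true h16

/-! ### Irreducibility of the four polynomials -/

theorem minpoly_int_eq_of_irreducible {α : ℝ} {P : ℤ[X]} (hP : P.Monic) (hirr : Irreducible P)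
    (h : aeval α P = 0) : minpoly ℤ α = P := by
  have hint : IsIntegral ℤ α := ⟨P, hP, h⟩
  obtain ⟨Q, hQ⟩ := minpoly.isIntegrallyClosed_dvd hint h
  have hu : IsUnit Q := (hirr.isUnit_or_isUnit hQ).resolve_left (minpoly.not_isUnit ℤ α)
  refine eq_of_monic_of_associated (minpoly.monic hint) hP ⟨hu.unit, ?_⟩
  rw [IsUnit.unit_spec, ← hQ]

theorem minpoly_int_eq_golden {α : ℝ} (h : α ^ 2 - α - 1 = 0) :
    minpoly ℤ α = X ^ 2 - X - 1 := by
  have hd : (X ^ 2 - X - 1 : ℤ[X]).natDegree = 2 := by compute_degree!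
  have hm : (X ^ 2 - X - 1 : ℤ[X]).Monic := by monicity!
  refine minpoly_int_eq_of_irreducible hm ?_ (by simpa using h)
  rw [hm.irreducible_iff_roots_eq_zero_of_degree_le_three (by rw [hd]) (by rw [hd]; norm_num)]
  refine Multiset.eq_zero_of_forall_notMem fun x hx => ?_
  have h1 : x ^ 2 - x - 1 = 0 := by simpa using isRoot_of_mem_roots hx
  have h2 := congrArg (Int.cast (R := ZMod 2)) h1
  push_cast at h2
  exact (by decide : ∀ x : ZMod 2, x ^ 2 - x - 1 ≠ 0) _ h2

theorem minpoly_int_eq_plastic {α : ℝ} (h : α ^ 3 - α - 1 = 0) :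
    minpoly ℤ α = X ^ 3 - X - 1 := by
  have hd : (X ^ 3 - X - 1 : ℤ[X]).natDegree = 3 := by compute_degree!
  have hm : (X ^ 3 - X - 1 : ℤ[X]).Monic := by monicity!
  refine minpoly_int_eq_of_irreducible hm ?_ (by simpa using h)
  rw [hm.irreducible_iff_roots_eq_zero_of_degree_le_three (by rw [hd]; norm_num) (by rw [hd])]
  refine Multiset.eq_zero_of_forall_notMem fun x hx => ?_
  have h1 : x ^ 3 - x - 1 = 0 := by simpa using isRoot_of_mem_roots hx
  have h2 := congrArg (Int.cast (R := ZMod 2)) h1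
  push_cast at h2
  exact (by decide : ∀ x : ZMod 2, x ^ 3 - x - 1 ≠ 0) _ h2

theorem minpoly_int_eq_cubic {α : ℝ} (h : α ^ 3 - 2 * α ^ 2 - α + 1 = 0) :
    minpoly ℤ α = X ^ 3 - 2 * X ^ 2 - X + 1 := by
  have hd : (X ^ 3 - 2 * X ^ 2 - X + 1 : ℤ[X]).natDegree = 3 := by compute_degree!
  have hm : (X ^ 3 - 2 * X ^ 2 - X + 1 : ℤ[X]).Monic := by monicity!
  refine minpoly_int_eq_of_irreducible hm ?_ (by simpa [map_ofNat] using h)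
  rw [hm.irreducible_iff_roots_eq_zero_of_degree_le_three (by rw [hd]; norm_num) (by rw [hd])]
  refine Multiset.eq_zero_of_forall_notMem fun x hx => ?_
  have h1 : x ^ 3 - 2 * x ^ 2 - x + 1 = 0 := by simpa using isRoot_of_mem_roots hx
  have h2 := congrArg (Int.cast (R := ZMod 2)) h1
  push_cast at h2
  exact (by decide : ∀ x : ZMod 2, x ^ 3 - 2 * x ^ 2 - x + 1 ≠ 0) _ h2

theorem minpoly_int_eq_quartic {α : ℝ} (h : α ^ 4 - α ^ 3 - 1 = 0) :
    minpoly ℤ α = X ^ 4 - X ^ 3 - 1 := by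
  have hd : (X ^ 4 - X ^ 3 - 1 : ℤ[X]).natDegree = 4 := by compute_degree!
  have hm : (X ^ 4 - X ^ 3 - 1 : ℤ[X]).Monic := by monicity!
  have hm1 : (X ^ 4 - X ^ 3 - 1 : ℤ[X]) ≠ 1 := fun h1 => by rw [h1] at hd; simp at hd
  refine minpoly_int_eq_of_irreducible hm ?_ (by simpa using h)
  rw [hm.irreducible_iff_lt_natDegree_lt hm1, hd]
  intro q hq hqd hdvd
  have hlead := hq.coeff_natDegree
  have hval : ∀ x : ℤ, q.eval x ∣ x ^ 4 - x ^ 3 - 1 := fun x => by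
    simpa using eval_dvd (x := x) hdvd
  obtain ⟨hq0, hq2⟩ := Finset.mem_Ioc.1 hqd
  have hunit : ∀ {k m : ℤ}, k ∣ m → IsUnit m → k = 1 ∨ k = -1 := fun h1 h2 =>
    Int.isUnit_iff.1 (isUnit_of_dvd_unit h1 h2)
  -- The quartic is `±1` at `0`, `1` and `-1`, which leaves only `x ^ 2 ± x - 1` as possible
  -- factors. These take the value `5` at `2` or `-2`, where the quartic is `7` and `23`.
  have h0 := hunit (hval 0) (by norm_num)
  have h1 := hunit (hval 1) (by norm_num)
  have h2 := hunit (hval (-1)) (by norm_num)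
  have h3 := hval 2
  have h4 := hval (-2)
  rcases (by omega : q.natDegree = 1 ∨ q.natDegree = 2) with hn | hn <;>
    rw [hn] at hlead <;>
    simp only [eval_eq_sum_range, hn, Finset.sum_range_succ, Finset.sum_range_zero, hlead]
      at h0 h1 h2 h3 h4 <;>
    norm_num at h0 h1 h2 h3 h4
  · omega
  · rcases h0 with h0 | h0 <;> rw [h0] at h1 h2 h3 h4
    · omega
    · rcases (by omega : q.coeff 1 = 1 ∨ q.coeff 1 = -1) with h5 | h5 <;> rw [h5] at h3 h4 <;>
        revert h3 h4 <;> decide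

theorem aeval_eq_of_natDegree_eq {A : Type*} [CommRing A] {M : ℤ[X]} {d : ℕ} (hM : M.Monic)
    (hd : M.natDegree = d) (x : A) :
    aeval x M = ∑ i ∈ Finset.range d, (M.coeff i : A) * x ^ i + x ^ d := by
  rw [aeval_eq_sum_range, hd, Finset.sum_range_succ, ← hd, hM.coeff_natDegree, one_smul]
  simp only [zsmul_eq_mul]

/-! ### Exact values for the four polynomials -/

namespace IsPisot

variable {α : ℝ}

theorem pisotL_eq_of_golden (hα : IsPisot α) (h : α ^ 2 - α - 1 = 0) : pisotL α = 1 / 5 := by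
  refine le_antisymm (pisotL_le_of_golden h) ?_
  have key := hα.le_pisotL_of_geom (q := 5) (g := 3) (r := 1) 1 (by norm_num)
    (by rw [minpoly_int_eq_golden h]; norm_num) fun n => ?_
  · simpa using key
  · have : (1 * 3 ^ n : ℤ) % 5 ∈ ({1, 2, 3, 4} : Finset ℤ) := by
      induction n with
      | zero => decide
      | succ n ih => simp only [pow_succ, Finset.mem_insert, Finset.mem_singleton] at ih ⊢; omega
    simp only [Finset.mem_insert, Finset.mem_singleton] at this
    omega

theorem pisotL_eq_of_plastic (hα : IsPisot α) (h : α ^ 3 - α - 1 = 0) : pisotL α = 1 / 5 := by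
  refine le_antisymm (pisotL_le_of_plastic h) ?_
  have key := hα.le_pisotL_of_geom (q := 5) (g := 2) (r := 1) 1 (by norm_num)
    (by rw [minpoly_int_eq_plastic h]; norm_num) fun n => ?_
  · simpa using key
  · have : (1 * 2 ^ n : ℤ) % 5 ∈ ({1, 2, 3, 4} : Finset ℤ) := by
      induction n with
      | zero => decide
      | succ n ih => simp only [pow_succ, Finset.mem_insert, Finset.mem_singleton] at ih ⊢; omega
    simp only [Finset.mem_insert, Finset.mem_singleton] at this
    omega

theorem pisotL_eq_of_cubic (hα : IsPisot α) (h : α ^ 3 - 2 * α ^ 2 - α + 1 = 0) :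
    pisotL α = 4 / 13 := by
  refine le_antisymm (pisotL_le_of_cubic h) ?_
  -- The cubic takes the value `377 = 13 * 29` at `8`, and the orbit of `4` modulo `13` is `4, 6, 9,
  -- 7`.
  have key := hα.le_pisotL_of_geom (q := 13) (g := 8) (r := 4) 4 (by norm_num)
    (by rw [minpoly_int_eq_cubic h]; norm_num) fun n => ?_
  · simpa using key
  · have : (4 * 8 ^ n : ℤ) % 13 ∈ ({4, 6, 9, 7} : Finset ℤ) := by
      induction n with
      | zero => decide
      | succ n ih => simp only [pow_succ, Finset.mem_insert, Finset.mem_singleton] at ih ⊢; omega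
    simp only [Finset.mem_insert, Finset.mem_singleton] at this
    omega

theorem pisotL_eq_of_quartic (hα : IsPisot α) (h : α ^ 4 - α ^ 3 - 1 = 0) :
    pisotL α = 3 / 17 := by
  refine le_antisymm (pisotL_le_of_quartic h) ?_
  -- The quartic takes the value `5831 = 17 * 343` at `9`, and the orbit of `3` modulo `17` stays in
  -- `[3, 14]`.
  have key := hα.le_pisotL_of_geom (q := 17) (g := 9) (r := 3) 3 (by norm_num)
    (by rw [minpoly_int_eq_quartic h]; norm_num) fun n => ?_
  · simpa using key
  · have : (3 * 9 ^ n : ℤ) % 17 ∈ ({3, 10, 5, 11, 14, 7, 12, 6} : Finset ℤ) := by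
      induction n with
      | zero => decide
      | succ n ih => simp only [pow_succ, Finset.mem_insert, Finset.mem_singleton] at ih ⊢; omega
    simp only [Finset.mem_insert, Finset.mem_singleton] at this
    omega

/-! ### Classification in degree at most four -/

theorem norm_lt_one_of_aeval_eq_zero (hα : IsPisot α) {z : ℂ}
    (hz : aeval z (minpoly ℤ α) = 0) (hne : z ≠ α) : ‖z‖ < 1 := by
  refine hα.2.2 z ?_ hne
  rw [← hα.map_minpoly_int]
  exact (aeval_map_algebraMap ℚ z (minpoly ℤ α)).trans hz

/-- The polynomial `x ^ 4 - x - 1` has a pair of complex roots outside the unit disc. -/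
theorem false_of_aeval_eq (hα : IsPisot α)
    (h : ∀ z : ℂ, aeval z (minpoly ℤ α) = z ^ 4 - z - 1) : False := by
  have hα1 := hα.2.1
  have h4 : α ^ 4 - α - 1 = 0 := by
    have h1 := h (algebraMap ℝ ℂ α)
    rw [aeval_algebraMap_apply, minpoly.aeval, map_zero, Complex.coe_algebraMap] at h1
    exact_mod_cast h1.symm
  -- The non-real roots have squared modulus `α ^ 2 + α * β + β ^ 2`, with `β` the negative root.
  -- The brackets for `α` and `β` are tight enough to make this exceed `1`.
  obtain ⟨β, ⟨hβ1, hβ2⟩, hβ⟩ : ∃ β ∈ Set.Icc (-0.73 : ℝ) (-0.72), β ^ 4 - β - 1 = 0 := by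
    have hcont : ContinuousOn (fun x : ℝ => x ^ 4 - x - 1) (Set.Icc (-0.73) (-0.72)) := by
      fun_prop
    exact intermediate_value_Icc' (by norm_num) hcont ⟨by norm_num, by norm_num⟩
  have hα2 : 1.22 < α := by
    by_contra! hle
    nlinarith [mul_nonneg (sub_nonneg.2 hα1.le) (sub_nonneg.2 hle), sq_nonneg α,
      mul_nonneg (sq_nonneg α) (mul_nonneg (sub_nonneg.2 hα1.le) (sub_nonneg.2 hle))]
  have h3 : α ^ 3 + α ^ 2 * β + α * β ^ 2 + β ^ 3 = 1 := by
    have hne : α - β ≠ 0 := by linarith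
    apply mul_left_cancel₀ hne
    linear_combination h4 - hβ
  set s : ℝ := √((3 * α ^ 2 + 2 * α * β + 3 * β ^ 2) / 4) with hs
  have hpos : 0 < 3 * α ^ 2 + 2 * α * β + 3 * β ^ 2 := by nlinarith [sq_nonneg (α + β)]
  have hs2 : s ^ 2 = (3 * α ^ 2 + 2 * α * β + 3 * β ^ 2) / 4 := Real.sq_sqrt (by linarith)
  have hs0 : 0 < s := Real.sqrt_pos.2 (by linarith)
  set z : ℂ := ⟨-(α + β) / 2, s⟩ with hz
  have hzI : z = -(α + β) / 2 + s * Complex.I := by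
    apply Complex.ext <;> simp [hz]
  have hS : z ^ 2 + (α + β) * z + (α ^ 2 + α * β + β ^ 2) = 0 := by
    have hs2' : (s : ℂ) ^ 2 = (3 * α ^ 2 + 2 * α * β + 3 * β ^ 2) / 4 := by exact_mod_cast hs2
    rw [hzI]
    linear_combination (s : ℂ) ^ 2 * Complex.I_sq - hs2'
  have h3' : (α : ℂ) ^ 3 + α ^ 2 * β + α * β ^ 2 + β ^ 3 = 1 := by exact_mod_cast h3
  have h4' : (α : ℂ) ^ 4 - α - 1 = 0 := by exact_mod_cast h4
  have hroot : aeval z (minpoly ℤ α) = 0 := by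
    rw [h]
    linear_combination (z - α) * (z - β) * hS + (z - α) * h3' + h4'
  have hlt := hα.norm_lt_one_of_aeval_eq_zero hroot fun he => by
    have := congrArg Complex.im he
    rw [hz, Complex.ofReal_im] at this
    exact hs0.ne' this
  have hn : ‖z‖ ^ 2 = α ^ 2 + α * β + β ^ 2 := by
    rw [← Complex.normSq_eq_norm_sq, hz, Complex.normSq_mk]
    linarith
  have : ‖z‖ ^ 2 < 1 := by nlinarith [norm_nonneg z]
  nlinarith

theorem lt_pisotL_of_aeval_I (hα : IsPisot α) {A B : ℤ}
    (h1 : (minpoly ℤ α).eval 1 = -1) (hI : aeval Complex.I (minpoly ℤ α) = A + B * Complex.I)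
    (h : 13 * (|A| + |B|) < 5 * (A ^ 2 + B ^ 2)) : 4 / 13 < pisotL α := by
  have hN : 0 < A ^ 2 + B ^ 2 := by linarith [abs_nonneg A, abs_nonneg B]
  have hN' : (0 : ℝ) < A ^ 2 + B ^ 2 := by exact_mod_cast hN
  have h' : 13 * (|(A : ℝ)| + |(B : ℝ)|) < 5 * (A ^ 2 + B ^ 2) := by exact_mod_cast h
  have key := hα.le_pisotL_of_aeval_I (A := A) (B := B)
    (c := 1 / 2 - (|(A : ℝ)| + |(B : ℝ)|) / (2 * (A ^ 2 + B ^ 2))) h1 hI hN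
    (by field_simp; linarith)
  refine lt_of_lt_of_le ?_ key
  -- The threshold is `5 / 26 = 1 / 2 - 4 / 13`.
  have : (|(A : ℝ)| + |(B : ℝ)|) / (2 * (A ^ 2 + B ^ 2)) < 5 / 26 := by
    rw [div_lt_div_iff₀ (by linarith) (by norm_num)]
    linarith
  linarith

theorem abs_le_three {A B : ℤ} (h : 5 * (A ^ 2 + B ^ 2) ≤ 13 * (|A| + |B|)) :
    |A| ≤ 3 ∧ |B| ≤ 3 := by
  have hA := sq_abs A
  have hB := sq_abs B
  constructor <;> by_contra! <;> nlinarith [sq_nonneg (10 * |A| - 13), sq_nonneg (10 * |B| - 13)]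

/-- Among the Pisot numbers of degree at most four, all but four have `L(α) > 4 / 13`. -/
theorem lt_pisotL_or (hα : IsPisot α) (hdeg : (minpoly ℚ α).natDegree ≤ 4) :
    4 / 13 < pisotL α ∨ α ^ 2 - α - 1 = 0 ∨ α ^ 3 - α - 1 = 0 ∨
      α ^ 3 - 2 * α ^ 2 - α + 1 = 0 ∨ α ^ 4 - α ^ 3 - 1 = 0 := by
  rw [or_iff_not_imp_left]
  intro hL
  have hα1 := hα.2.1
  have hthird : ∀ g : ℤ, g ^ 2 = 1 → |(minpoly ℤ α).eval g| < 2 := by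
    intro g hg
    by_contra! h
    exact hL (lt_of_lt_of_le (by norm_num) (hα.third_le_pisotL_of_sq_eq_one hg h))
  have e1 : (minpoly ℤ α).eval 1 = -1 := by
    have h1 := abs_lt.1 (hthird 1 (by norm_num))
    have h2 := hα.eval_one_neg
    omega
  have hI : ∀ A B : ℤ, aeval Complex.I (minpoly ℤ α) = A + B * Complex.I →
      5 * (A ^ 2 + B ^ 2) ≤ 13 * (|A| + |B|) :=
    fun A B h => not_lt.1 fun h' => hL (hα.lt_pisotL_of_aeval_I e1 h h')
  have e2 := abs_lt.1 (hthird (-1) (by norm_num))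
  have e3 := hα.eval_neg_one_pos
  have hc0 : (minpoly ℤ α).coeff 0 ≠ 0 := by
    have := minpoly.coeff_zero_ne_zero (A := ℚ) (x := α) hα.1.tower_top (by linarith)
    rw [← hα.map_minpoly_int, coeff_map] at this
    exact fun h => this (by simp [h])
  have hnorm := hα.abs_coeff_zero_le
  have hroot := minpoly.aeval ℤ α
  have hmon := minpoly.monic hα.1
  have hpos := minpoly.natDegree_pos hα.1
  rw [← hα.natDegree_minpoly_int] at hdeg
  simp only [← coe_aeval_eq_eval] at e1 e2 e3
  obtain ⟨d, hd⟩ : ∃ d, (minpoly ℤ α).natDegree = d := ⟨_, rfl⟩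
  have hfour := hα.false_of_aeval_eq
  rw [hd] at hdeg hpos e3
  simp only [aeval_eq_of_natDegree_eq hmon hd] at e1 e2 e3 hI hroot hfour
  generalize minpoly ℤ α = M at *
  have hI2 := Complex.I_sq
  have hI3 := Complex.I_pow_three
  interval_cases d <;>
    simp only [Finset.sum_range_succ, Finset.sum_range_zero] at e1 e2 e3 hI hroot hfour <;>
    norm_num at e1 e2 e3 hroot
  · omega
  · left
    have h0 : M.coeff 0 = -1 := by omega
    have h1 : M.coeff 1 = -1 := by omega
    rw [h0, h1] at hroot
    push_cast at hroot
    linarith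
  · have h1 : M.coeff 1 = -1 := by omega
    have h0 : M.coeff 0 = -1 - M.coeff 2 := by omega
    rw [h0] at hc0 hnorm hroot
    rw [h1] at hroot
    simp only [h0, h1] at hI
    have hle := abs_le_three (hI (-1 - 2 * M.coeff 2) (-2) (by
      push_cast; linear_combination (M.coeff 2 : ℂ) * hI2 + hI3))
    have h2 := abs_le.1 hle.1
    rcases (by omega : M.coeff 2 = -2 ∨ M.coeff 2 = -1 ∨ M.coeff 2 = 0 ∨ M.coeff 2 = 1) with
      h2 | h2 | h2 | h2 <;> rw [h2] at hc0 hnorm hroot <;> norm_num at hroot hnorm hc0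
    · right; right; left; linarith
    · right; left; linarith
    -- Here the constant term is `-2`, so `α ≥ 2`, where `x ^ 3 + x ^ 2 - x - 2` is positive.
    · nlinarith [mul_nonneg (mul_self_nonneg α) (sub_nonneg.2 hnorm)]
  · have h1 : M.coeff 1 = -1 - M.coeff 3 := by omega
    have h0 : M.coeff 0 = -1 - M.coeff 2 := by omega
    rw [h0] at hc0 hnorm hroot
    rw [h1] at hroot
    simp only [h0, h1] at hI hfour
    have hI' := hI (-2 * M.coeff 2) (-1 - 2 * M.coeff 3) (by
      push_cast; linear_combination (M.coeff 2 : ℂ) * hI2 + (M.coeff 3 : ℂ) * hI3)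
    have hle := abs_le_three hI'
    have h2 := abs_le.1 hle.1
    have h3 := abs_le.1 hle.2
    -- The value `-1` would make the constant term zero.
    rcases (by omega : M.coeff 2 = 0 ∨ M.coeff 2 = 1) with h2 | h2 <;>
    rcases (by omega : M.coeff 3 = -2 ∨ M.coeff 3 = -1 ∨ M.coeff 3 = 0 ∨ M.coeff 3 = 1) with
      h3 | h3 | h3 | h3 <;> rw [h2] at hc0 hnorm hroot hI' <;> rw [h3] at hroot hI' <;>
      norm_num at hroot hnorm hI'
    · right; right; right; linarith
    · refine (hfour fun z => ?_).elim
      rw [h2, h3]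
      push_cast
      ring
    -- The remaining cases have constant term `-2`, so `α ≥ 2` is too large to be a root. The test
    -- at `i` alone does not suffice: it holds with equality for `|A| = 2`, `|B| = 3`.
    all_goals
      have h5 := mul_self_nonneg α
      have h6 := mul_nonneg h5 (sub_nonneg.2 hnorm)
      have h7 := mul_nonneg h5 h6
      nlinarith [mul_nonneg h5 h5, mul_nonneg (sub_nonneg.2 hnorm) h6]

end IsPisot

theorem corollary2 (α : ℝ) (hα : IsPisot α) (hdeg : (minpoly ℚ α).natDegree ≤ 4) :
    (pisotL α = 3 / 17 ↔ α ^ 4 - α ^ 3 - 1 = 0) ∧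
    (pisotL α = 1 / 5 ↔ (α ^ 2 - α - 1 = 0 ∨ α ^ 3 - α - 1 = 0)) ∧
    (pisotL α = 4 / 13 ↔ α ^ 3 - 2 * α ^ 2 - α + 1 = 0) := by
  have hcases : 4 / 13 < pisotL α ∨
      (pisotL α = 1 / 5 ∧ (α ^ 2 - α - 1 = 0 ∨ α ^ 3 - α - 1 = 0)) ∨
      (pisotL α = 4 / 13 ∧ α ^ 3 - 2 * α ^ 2 - α + 1 = 0) ∨
      (pisotL α = 3 / 17 ∧ α ^ 4 - α ^ 3 - 1 = 0) := by
    rcases hα.lt_pisotL_or hdeg with h | h | h | h | h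
    · exact Or.inl h
    · exact Or.inr (Or.inl ⟨hα.pisotL_eq_of_golden h, Or.inl h⟩)
    · exact Or.inr (Or.inl ⟨hα.pisotL_eq_of_plastic h, Or.inr h⟩)
    · exact Or.inr (Or.inr (Or.inl ⟨hα.pisotL_eq_of_cubic h, h⟩))
    · exact Or.inr (Or.inr (Or.inr ⟨hα.pisotL_eq_of_quartic h, h⟩))
  refine ⟨⟨fun h => ?_, hα.pisotL_eq_of_quartic⟩,
    ⟨fun h => ?_, fun h => h.elim hα.pisotL_eq_of_golden hα.pisotL_eq_of_plastic⟩,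
    ⟨fun h => ?_, hα.pisotL_eq_of_cubic⟩⟩ <;> rw [h] at hcases <;> norm_num at hcases <;>
    tauto
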